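/- Let $q$ be an odd prime power. For $b \in \mathbb{F}_{q^6}$ let $$U_b = \{(x,\, b x^{q} + x^{q^4}) : x \in \mathbb{F}_{q^6}\},$$ an $\mathbb{F}_q$-subspace of $\mathbb{F}_{q^6} \times \mathbb{F}_{q^6}$. An $\mathbb{F}_q$-subspace $U$ of an $r$-dimensional $\mathbb{F}_{q^n}$-vector space $V$ is called scattered if $\dim_{\mathbb{F}_q}(U \cap \langle v \rangle_{\mathbb{F}_{q^n}}) \le 1$ for every nonzero $v \in V$, and maximum scattered if moreover $\dim_{\mathbb{F}_q} U = rn/2$. Let $$\Gamma = \{ \mathrm{N}_{q^6/q^3}(b) : b \in \mathbb{F}_{q^6},\ U_b \text{ is maximum scattered} \} \subseteq \mathbb{F}_{q^3},$$ where $\mathrm{N}_{q^6/q^3}(b) = b^{q^3+1}$ is the norm of $b$ from $\mathbb{F}_{q^6}$ to $\mathbb{F}_{q^3}$. Then $$|\Gamma| = \tfrac12\left(q^3 - q^2 - q - 3\right).$$ Equivalently, $|\Gamma| = \lfloor (q^2+q+1)(q-2)/2 \rfloor$, as conjectured by Csajbók, Marino, Polverino and Zanella. -/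

import Mathlib

namespace LinearSets

/-- An `𝔽_q`-subspace `U` of an `𝔽_{q^n}`-vector space `V` is scattered (with respect to the
Desarguesian spread) if it meets every line `⟨v⟩` over `𝔽_{q^n}` in an `𝔽_q`-subspace of dimension
at most one. Here `K = 𝔽_q` and `L = 𝔽_{q^n}`. -/
def IsScattered (K L : Type*) {V : Type*} [Field K] [Field L] [Algebra K L]
    [AddCommGroup V] [Module K V] [Module L V] [IsScalarTower K L V]
    (U : Submodule K V) : Prop :=
  ∀ v : V, v ≠ 0 →
    Module.finrank K (U ⊓ (Submodule.span L {v}).restrictScalars K : Submodule K V) ≤ 1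

/-- A scattered subspace is maximum scattered if its `𝔽_q`-dimension is `r n / 2`, where
`r = dim V` over `𝔽_{q^n}`. -/
def IsMaximumScattered (K L : Type*) {V : Type*} [Field K] [Field L] [Algebra K L]
    [AddCommGroup V] [Module K V] [Module L V] [IsScalarTower K L V]
    (U : Submodule K V) : Prop :=
  IsScattered K L U ∧
    2 * Module.finrank K U = Module.finrank L V * Module.finrank K L

/-- The `𝔽_q`-subspace `U_b = {(x, b x^q + x^(q^4)) : x ∈ L}` of `L × L`, with `q = |K|`. -/
def U (K : Type*) {L : Type*} [Field K] [Fintype K] [Field L] [Algebra K L] (b : L) :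
    Submodule K (L × L) where
  carrier := {p | ∃ x : L, p = (x, b * x ^ Fintype.card K + x ^ (Fintype.card K) ^ 4)}
  zero_mem' := ⟨0, by simp [Fintype.card_ne_zero]; rfl⟩
  add_mem' := by
    rintro _ _ ⟨x, rfl⟩ ⟨y, rfl⟩
    refine ⟨x + y, ?_⟩
    have h1 : (x + y) ^ Fintype.card K = x ^ Fintype.card K + y ^ Fintype.card K :=
      map_add (FiniteField.frobeniusAlgHom K L) x y
    have h4 : (x + y) ^ (Fintype.card K) ^ 4
        = x ^ (Fintype.card K) ^ 4 + y ^ (Fintype.card K) ^ 4 := by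
      have hp : ∀ z : L, (FiniteField.frobeniusAlgHom K L ^ 4) z = z ^ (Fintype.card K) ^ 4 := by
        intro z
        rw [AlgHom.coe_pow, FiniteField.coe_frobeniusAlgHom, pow_iterate]
      rw [← hp, ← hp, ← hp, map_add]
    rw [Prod.mk_add_mk, h1, h4]
    ring_nf
  smul_mem' := by
    rintro c _ ⟨x, rfl⟩
    refine ⟨c • x, ?_⟩
    rw [Prod.smul_mk, smul_pow, smul_pow, FiniteField.pow_card_pow, FiniteField.pow_card,
      mul_smul_comm, smul_add]

/-- The set `Γ` of the norms `N_{q^6/q^3}(b)` of those `b` for which `U_b` is maximum scattered.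
Here `K = 𝔽_q`, `M = 𝔽_{q^3}` and `L = 𝔽_{q^6}`. -/
def Gam (K M L : Type*) [Field K] [Fintype K] [Field M] [Field L]
    [Algebra K L] [Algebra M L] : Set M :=
  {w | ∃ b : L, IsMaximumScattered K L (U K b) ∧ Algebra.norm M b = w}

end LinearSets

namespace LinearSets


/-! Failure of scatteredness means f(zx) = z f(x) for some x ≠ 0 and some z outside K, where f is
the binomial map. By Hilbert 90 for L/M, x can be eliminated: such a z works exactly when N(b) N(z^q
- z) = N(z^(q^4) - z), with N the norm to M. Let d be a nonsquare of K, ω² = d and z = s + tω with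
s, t in M; put w = N(b) ≠ 1, A = w/(w - 1) and a = σs - s. The equation becomes a² = d((t - σt)² +
4A tσt) with Tr a = 0 and t ≠ 0, which is `Solvable`.

The obstruction is an identity (`discr_identity`): on a solution, d³(4 N(t))² kap(A) is a square in
K, so kap(A) cannot be a nonzero square. Conversely, the condition Tr a = 0 yields Heron's relation
among the conjugates of a², which becomes a K-rational conic in u = 1/t. A conic over a finite field
has a point. If kap(A) is a nonsquare, any such point solves the equation; if kap(A) = 0, the conic
is a double line, on which a suitable point is found by another ternary form (`solvable_iff`).

Thus Γ corresponds, under w ↦ w/(w - 1), to the A ≠ 1 with kap(A) a nonzero square. These are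
counted along lines through 0: kap(lB)/l² is affine in l, with constant term a ternary quadratic
form equivalent to a discriminant. -/

/-! ### Ternary quadratic forms and Heron's relation -/

open Polynomial in
theorem exists_isotropic_of_finrank_eq_three {F V : Type*} [Field F] [Finite F] [AddCommGroup V]
    [Module F V] (h2 : ringChar F ≠ 2) (hV : Module.finrank F V = 3) (Q : QuadraticForm F V) :
    ∃ v ≠ 0, Q v = 0 := by
  classical
  have := Fintype.ofFinite F
  have := invertibleOfNonzero (Ring.two_ne_zero h2)
  have : FiniteDimensional F V := Module.finite_of_finrank_pos (by omega)
  obtain ⟨w, ⟨e⟩⟩ := QuadraticForm.equivalent_weightedSumSquares Q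
  suffices h : ∃ x : Fin (Module.finrank F V) → F, x ≠ 0 ∧
      QuadraticMap.weightedSumSquares F w x = 0 by
    obtain ⟨x, hx, h0⟩ := h
    refine ⟨e.symm x, by simpa using hx, ?_⟩
    rw [← h0]
    exact e.symm.map_app x
  generalize Module.finrank F V = n at hV w
  subst hV
  simp only [QuadraticMap.weightedSumSquares_apply, Fin.sum_univ_three, smul_eq_mul]
  by_cases h0 : w 0 = 0
  · refine ⟨![1, 0, 0], fun h => one_ne_zero (congrFun h 0), by simp [h0]⟩
  by_cases h1 : w 1 = 0
  · refine ⟨![0, 1, 0], fun h => one_ne_zero (congrFun h 1), by simp [h1]⟩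
  -- Set the last coordinate to 1: the value sets of w₀X² + w₂ and -w₁X² have (|F| + 1)/2 elements
  -- each, so they meet.
  obtain ⟨a, b, hab⟩ := FiniteField.exists_root_sum_quadratic
    (f := C (w 0) * X ^ 2 + C 0 * X + C (w 2)) (g := C (w 1) * X ^ 2 + C 0 * X + C 0)
    (degree_quadratic h0) (degree_quadratic h1) (FiniteField.odd_card_of_char_ne_two h2)
  refine ⟨![a, b, 1], fun h => one_ne_zero (congrFun h 2), ?_⟩
  simp at hab ⊢
  linear_combination hab

/-- A quadratic map on a three-dimensional space whose values are scalars has a nontrivial zero. -/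
theorem exists_isotropic_of_mem_range {F V A : Type*} [Field F] [Finite F] [AddCommGroup V]
    [Module F V] [Ring A] [Nontrivial A] [Algebra F A] (h2 : ringChar F ≠ 2)
    (hV : Module.finrank F V = 3)
    (Q : QuadraticMap F V A) (hQ : ∀ v, ∃ k, algebraMap F A k = Q v) :
    ∃ v ≠ 0, Q v = 0 := by
  obtain ⟨φ, hφ⟩ := LinearMap.exists_leftInverse_of_injective (Algebra.linearMap F A)
    (LinearMap.ker_eq_bot.2 (algebraMap F A).injective)
  obtain ⟨v, hv, h0⟩ := exists_isotropic_of_finrank_eq_three h2 hV (φ.compQuadraticMap Q)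
  refine ⟨v, hv, ?_⟩
  obtain ⟨k, hk⟩ := hQ v
  have h1 : φ (algebraMap F A k) = k := LinearMap.congr_fun hφ k
  rw [LinearMap.compQuadraticMap_apply, ← hk, h1] at h0
  rw [← hk, h0, map_zero]

/-- If `R₁, R₂, R₃` are squares `aᵢ²` up to a common factor and satisfy Heron's relation, then
up to signs `a₁ + a₂ + a₃ = 0`. -/
theorem heron_factor {F : Type*} [Field F] {a₁ a₂ a₃ : F}
    (h : a₁ ^ 4 + a₂ ^ 4 + a₃ ^ 4 - 2 * (a₁ ^ 2 * a₂ ^ 2 + a₂ ^ 2 * a₃ ^ 2 + a₁ ^ 2 * a₃ ^ 2) = 0) :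
    a₁ + a₂ + a₃ = 0 ∨ a₁ = a₂ + a₃ ∨ a₂ = a₃ + a₁ ∨ a₃ = a₁ + a₂ := by
  have : (a₁ + a₂ + a₃) * ((a₁ - (a₂ + a₃)) * ((a₂ - (a₃ + a₁)) * (a₃ - (a₁ + a₂)))) = 0 := by
    linear_combination h
  rcases mul_eq_zero.1 this with h | h
  · exact .inl h
  rcases mul_eq_zero.1 h with h | h
  · exact .inr (.inl (sub_eq_zero.1 h))
  rcases mul_eq_zero.1 h with h | h
  · exact .inr (.inr (.inl (sub_eq_zero.1 h)))
  · exact .inr (.inr (.inr (sub_eq_zero.1 h)))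

/-- Each Aᵢ is determined by its equation; after substituting these and a₃ = -a₁ - a₂, the two sides
agree identically. The expression squared on the left is cyclically invariant, so it descends to K
when the indices are Galois conjugates. -/
theorem discr_identity {F : Type*} [Field F] {d a₁ a₂ a₃ t₁ t₂ t₃ A₁ A₂ A₃ : F}
    (h₁ : a₁ ^ 2 = d * ((t₁ - t₂) ^ 2 + 4 * A₁ * (t₁ * t₂)))
    (h₂ : a₂ ^ 2 = d * ((t₂ - t₃) ^ 2 + 4 * A₂ * (t₂ * t₃)))
    (h₃ : a₃ ^ 2 = d * ((t₃ - t₁) ^ 2 + 4 * A₃ * (t₃ * t₁)))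
    (h : a₁ + a₂ + a₃ = 0) (hd : d ≠ 0) (h2 : (2 : F) ≠ 0)
    (ht₁ : t₁ ≠ 0) (ht₂ : t₂ ≠ 0) (ht₃ : t₃ ≠ 0) :
    (a₁ * a₂ * a₃ + d * (a₁ * t₃ ^ 2 + a₂ * t₁ ^ 2 + a₃ * t₂ ^ 2)) ^ 2 =
      d ^ 3 * (4 * (t₁ * t₂ * t₃)) ^ 2 * (A₁ ^ 2 + A₂ ^ 2 + A₃ ^ 2
        - 2 * (A₁ * A₂ + A₂ * A₃ + A₁ * A₃) + 4 * (A₁ * A₂ * A₃)) := by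
  have h4 : (4 : F) ≠ 0 := by
    have : (4 : F) = 2 * 2 := by norm_num
    rw [this]; exact mul_ne_zero h2 h2
  have e₁ : A₁ = (a₁ ^ 2 - d * (t₁ - t₂) ^ 2) / (4 * d * (t₁ * t₂)) := by
    rw [h₁]; field_simp; ring
  have e₂ : A₂ = (a₂ ^ 2 - d * (t₂ - t₃) ^ 2) / (4 * d * (t₂ * t₃)) := by
    rw [h₂]; field_simp; ring
  have e₃ : A₃ = (a₃ ^ 2 - d * (t₃ - t₁) ^ 2) / (4 * d * (t₃ * t₁)) := by
    rw [h₃]; field_simp; ring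
  obtain rfl : a₃ = -a₁ - a₂ := by linear_combination h
  rw [e₁, e₂, e₃]
  field_simp
  ring


/-! ### The norm equation over a cubic extension: obstruction and conic -/

/-- `σ` behaves as a generator of the Galois group of the cubic extension `M / K`. -/
structure IsCubicGenerator {K M : Type*} [Field K] [Field M] [Algebra K M] (σ : M →ₐ[K] M) :
    Prop where
  finrank_eq : Module.finrank K M = 3
  cube : ∀ x, σ (σ (σ x)) = x
  fixed : ∀ x, σ x = x → ∃ k, algebraMap K M k = x
  trace_eq : ∀ x, algebraMap K M (Algebra.trace K M x) = x + σ x + σ (σ x)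
  norm_eq : ∀ x, algebraMap K M (Algebra.norm K x) = x * σ x * σ (σ x)

/-- The cubic form whose quadratic character decides which norms occur. -/
noncomputable def kap (K : Type*) {M : Type*} [Field K] [Field M] [Algebra K M] (A : M) : K :=
  2 * Algebra.trace K M (A ^ 2) - Algebra.trace K M A ^ 2 + 4 * Algebra.norm K A

/-- Solvability of the norm equation `IsBadNorm` below in the coordinate `A = w / (w - 1)`. -/
def Solvable {K M : Type*} [Field K] [Field M] [Algebra K M] (σ : M →ₐ[K] M) (d : K) (A : M) :
    Prop :=
  ∃ a t : M, t ≠ 0 ∧ a + σ a + σ (σ a) = 0 ∧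
    a ^ 2 = algebraMap K M d * ((t - σ t) ^ 2 + 4 * A * (t * σ t))

section

variable {K M : Type*} [Field K] [Field M] [Algebra K M] {σ : M →ₐ[K] M}

theorem IsCubicGenerator.algebraMap_kap (hσ : IsCubicGenerator σ) (A : M) :
    algebraMap K M (kap K A) = A ^ 2 + σ A ^ 2 + σ (σ A) ^ 2
      - 2 * (A * σ A + σ A * σ (σ A) + A * σ (σ A)) + 4 * (A * σ A * σ (σ A)) := by
  simp only [kap, map_add, map_sub, map_mul, map_pow, hσ.trace_eq, hσ.norm_eq, map_ofNat]
  ring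

/-- The degree is odd: the norm of k is k³, which differs from k by a square. -/
theorem IsCubicGenerator.isSquare_algebraMap_iff (hσ : IsCubicGenerator σ) (k : K) :
    IsSquare (algebraMap K M k) ↔ IsSquare k := by
  refine ⟨?_, fun h => h.map _⟩
  rintro ⟨y, hy⟩
  rcases eq_or_ne k 0 with rfl | hk
  · exact ⟨0, by simp⟩
  have h := congrArg (Algebra.norm K) hy
  rw [Algebra.norm_algebraMap, hσ.finrank_eq, map_mul] at h
  exact ⟨Algebra.norm K y / k, by field_simp; linear_combination h⟩

/-- Each of the other sign patterns forces a = 0: comparing x = σx + σ²x with its conjugate gives σx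
= x, hence x = 2x. -/
theorem IsCubicGenerator.trace_eq_zero_of_heron (hσ : IsCubicGenerator σ) (h2 : (2 : M) ≠ 0)
    {a : M} (h : a + σ a + σ (σ a) = 0 ∨ a = σ a + σ (σ a) ∨ σ a = σ (σ a) + a ∨
      σ (σ a) = a + σ a) : a + σ a + σ (σ a) = 0 := by
  have key : ∀ x, x = σ x + σ (σ x) → x = 0 := by
    intro x hx
    have h' := congrArg σ hx
    rw [map_add, hσ.cube] at h'
    have h1 : 2 * (x - σ x) = 0 := by linear_combination hx - h'
    have h1' : σ x = x := (sub_eq_zero.1 ((mul_eq_zero.1 h1).resolve_left h2)).symm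
    rw [h1', h1'] at hx
    linear_combination -hx
  rcases h with h | h | h | h
  · exact h
  · rw [key a h]; simp
  · have := key (σ a) (by rw [hσ.cube]; exact h)
    rw [this] at h ⊢
    simp at h ⊢
    exact h.symm ▸ rfl
  · have := key (σ (σ a)) (by rw [hσ.cube]; exact h)
    have e := hσ.cube a
    rw [this, map_zero] at e
    rw [← e]; simp

theorem IsCubicGenerator.isSquare_mul_kap (hσ : IsCubicGenerator σ) (h2 : (2 : M) ≠ 0) {d : K}
    (hd : d ≠ 0) {A : M} (h : Solvable σ d A) : IsSquare (d * kap K A) := by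
  obtain ⟨a, t, ht, htr, h₁⟩ := h
  have ht' : σ t ≠ 0 := (map_ne_zero σ).2 ht
  have ht'' : σ (σ t) ≠ 0 := (map_ne_zero σ).2 ht'
  have hd' : algebraMap K M d ≠ 0 := (map_ne_zero _).2 hd
  have h₂ := congrArg σ h₁
  have h₃ := congrArg σ h₂
  simp only [map_add, map_sub, map_mul, map_pow, AlgHom.commutes, map_ofNat, hσ.cube] at h₂ h₃
  have key := discr_identity h₁ h₂ h₃ htr hd' h2 ht ht' ht''
  obtain ⟨g, hg⟩ := hσ.fixed (a * σ a * σ (σ a) + algebraMap K M d *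
    (a * σ (σ t) ^ 2 + σ a * t ^ 2 + σ (σ a) * σ t ^ 2)) (by
      simp only [map_add, map_mul, map_pow, AlgHom.commutes, hσ.cube]; ring)
  rw [← hg, ← hσ.algebraMap_kap, ← hσ.norm_eq] at key
  have key' : g ^ 2 = d ^ 3 * (4 * Algebra.norm K t) ^ 2 * kap K A := by
    apply (algebraMap K M).injective
    simpa only [map_mul, map_pow, map_ofNat] using key
  have hN : Algebra.norm K t ≠ 0 := by
    intro h0
    have := hσ.norm_eq t
    rw [h0, map_zero] at this
    exact mul_ne_zero (mul_ne_zero ht ht') ht'' this.symm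
  have h4 : (4 : K) ≠ 0 := by
    intro h0
    have : (algebraMap K M) 4 = 2 * 2 := by rw [map_ofNat]; norm_num
    rw [h0, map_zero] at this
    exact mul_ne_zero h2 h2 this.symm
  refine ⟨g / (d * (4 * Algebra.norm K t)), ?_⟩
  field_simp
  linear_combination -key'

/-- The conic obtained from Heron's relation in the coordinate `u = 1 / t`. -/
def conic (σ : M →ₐ[K] M) (A u : M) : M :=
  A * (σ (σ u) - σ u) * (u - σ (σ u)) + σ A * (u - σ (σ u)) * (σ u - u)
    + σ (σ A) * (σ u - u) * (σ (σ u) - σ u)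
    + A ^ 2 * σ (σ u) ^ 2 + σ A ^ 2 * u ^ 2 + σ (σ A) ^ 2 * σ u ^ 2
    - 2 * (A * σ A * u * σ (σ u) + σ A * σ (σ A) * u * σ u + A * σ (σ A) * σ u * σ (σ u))

theorem IsCubicGenerator.solvable_of_conic (hσ : IsCubicGenerator σ) (h2 : (2 : M) ≠ 0) {d : K}
    (hd : d ≠ 0) {A u b : M} (hu : u ≠ 0) (hC : conic σ A u = 0)
    (hS : (u - σ u) ^ 2 + 4 * A * (u * σ u) = algebraMap K M d * b ^ 2) : Solvable σ d A := by
  have hu' : σ u ≠ 0 := (map_ne_zero σ).2 hu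
  have hu'' : σ (σ u) ≠ 0 := (map_ne_zero σ).2 hu'
  have hd' : algebraMap K M d ≠ 0 := (map_ne_zero _).2 hd
  have h₁ : (algebraMap K M d * b / (u * σ u)) ^ 2 =
      algebraMap K M d * ((u⁻¹ - σ u⁻¹) ^ 2 + 4 * A * (u⁻¹ * σ u⁻¹)) := by
    rw [map_inv₀]
    field_simp
    linear_combination -hS
  refine ⟨algebraMap K M d * b / (u * σ u), u⁻¹, inv_ne_zero hu, ?_, h₁⟩
  apply hσ.trace_eq_zero_of_heron h2
  apply heron_factor
  have h₂ := congrArg σ h₁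
  have h₃ := congrArg σ h₂
  generalize algebraMap K M d * b / (u * σ u) = a at *
  simp only [map_add, map_sub, map_mul, map_pow, AlgHom.commutes, map_ofNat, hσ.cube,
    map_inv₀] at h₁ h₂ h₃
  -- Heron's relation involves only the squares of the conjugates of a, and these are known in terms
  -- of u.
  have e : ∀ x : M, x ^ 4 = (x ^ 2) ^ 2 := fun x => by ring
  rw [e, e, e, h₁, h₂, h₃]
  unfold conic at hC
  field_simp
  linear_combination 16 * algebraMap K M d ^ 2 * (u * σ u * σ (σ u)) ^ 2 * hC

end


/-! ### The solvability criterion -/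

section

variable {K M : Type*} [Field K] [Field M] [Algebra K M] {σ : M →ₐ[K] M}

theorem isSquare_or_of_not_isSquare {F : Type*} [Field F] [Finite F]
    {d : F} (hd : ¬IsSquare d) (x : F) : ∃ y, x = y ^ 2 ∨ x = d * y ^ 2 := by
  classical
  have := Fintype.ofFinite F
  by_cases hx : IsSquare x
  · obtain ⟨y, rfl⟩ := hx
    exact ⟨y, .inl (by ring)⟩
  have hd0 : d ≠ 0 := by rintro rfl; exact hd (by simp)
  have hx0 : x ≠ 0 := by rintro rfl; exact hx (by simp)
  have h : IsSquare (x * d) := by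
    rw [← quadraticChar_one_iff_isSquare (mul_ne_zero hx0 hd0), map_mul,
      quadraticChar_neg_one_iff_not_isSquare.2 hx, quadraticChar_neg_one_iff_not_isSquare.2 hd]
    norm_num
  obtain ⟨y, hy⟩ := h
  refine ⟨y / d, .inr ?_⟩
  field_simp
  linear_combination hy

/-- The conic is σ-invariant, hence a K-valued quadratic form on the three-dimensional K-space M. -/
theorem IsCubicGenerator.exists_conic_eq_zero [Finite K] (hσ : IsCubicGenerator σ)
    (h2 : ringChar K ≠ 2) (A : M) : ∃ u ≠ 0, conic σ A u = 0 := by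
  let m : M → M →ₗ[K] M := fun x => LinearMap.mulLeft K x
  let i : M →ₗ[K] M := LinearMap.id
  let s : M →ₗ[K] M := σ.toLinearMap
  let s' : M →ₗ[K] M := s ∘ₗ s
  let Q : QuadraticMap K M M :=
    .linMulLin (m A ∘ₗ (s' - s)) (i - s') + .linMulLin (m (σ A) ∘ₗ (i - s')) (s - i)
    + .linMulLin (m (σ (σ A)) ∘ₗ (s - i)) (s' - s)
    + .linMulLin (m A ∘ₗ s') (m A ∘ₗ s') + .linMulLin (m (σ A) ∘ₗ i) (m (σ A) ∘ₗ i)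
    + .linMulLin (m (σ (σ A)) ∘ₗ s) (m (σ (σ A)) ∘ₗ s)
    - .linMulLin (m (2 * A * σ A) ∘ₗ i) s' - .linMulLin (m (2 * σ A * σ (σ A)) ∘ₗ i) s
    - .linMulLin (m (2 * A * σ (σ A)) ∘ₗ s) s'
  have hQ : ∀ u, Q u = conic σ A u := by
    intro u
    simp [Q, m, i, s, s', conic]
    ring
  obtain ⟨u, hu, h⟩ := exists_isotropic_of_mem_range h2 hσ.finrank_eq Q (by
    intro u
    apply hσ.fixed
    rw [hQ]
    simp only [conic, map_add, map_sub, map_mul, map_pow, map_ofNat, hσ.cube]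
    ring)
  exact ⟨u, hu, by rw [← hQ, h]⟩

theorem IsCubicGenerator.solvable_of_not_isSquare [Finite K] (hσ : IsCubicGenerator σ)
    (h2 : ringChar K ≠ 2) {d : K} (hd : ¬IsSquare d) {A : M} (hA : ¬IsSquare (kap K A)) :
    Solvable σ d A := by
  have : Module.Finite K M := Module.finite_of_finrank_pos (by rw [hσ.finrank_eq]; norm_num)
  have : Finite M := Module.finite_of_finite K
  have h2M : (2 : M) ≠ 0 := by
    rw [← map_ofNat (algebraMap K M) 2]
    exact (map_ne_zero _).2 (Ring.two_ne_zero h2)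
  have hd0 : d ≠ 0 := by rintro rfl; exact hd (by simp)
  obtain ⟨u, hu, hC⟩ := hσ.exists_conic_eq_zero h2 A
  obtain ⟨b, hb | hb⟩ := isSquare_or_of_not_isSquare
    (mt (hσ.isSquare_algebraMap_iff d).1 hd) ((u - σ u) ^ 2 + 4 * A * (u * σ u))
  -- If the value at u were a square, the equation would be solvable with 1 in place of d, making
  -- kap(A) a square.
  · have := hσ.isSquare_mul_kap h2M one_ne_zero
      (hσ.solvable_of_conic (b := b) h2M one_ne_zero hu hC (by rw [hb]; simp))
    rw [one_mul] at this
    exact absurd this hA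
  · exact hσ.solvable_of_conic h2M hd0 hu hC hb

/-- With A(A - 1) = κl², the conic degenerates to κ Tr(σl · u)². Its zeros are u = v/σl with Tr v =
0, and it remains to find v ≠ 0 at which the required expression is d times a square. -/
theorem IsCubicGenerator.solvable_of_kap_eq_zero [Finite K] (hσ : IsCubicGenerator σ)
    (h2 : ringChar K ≠ 2) {d : K} (hd : ¬IsSquare d) {A : M} (hA : kap K A = 0) (hA1 : A ≠ 1) :
    Solvable σ d A := by
  have : Module.Finite K M := Module.finite_of_finrank_pos (by rw [hσ.finrank_eq]; norm_num)
  have : Finite M := Module.finite_of_finite K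
  have h2M : (2 : M) ≠ 0 := by
    rw [← map_ofNat (algebraMap K M) 2]
    exact (map_ne_zero _).2 (Ring.two_ne_zero h2)
  have hd0 : d ≠ 0 := by rintro rfl; exact hd (by simp)
  rcases eq_or_ne A 0 with rfl | hA0
  · exact ⟨0, 1, one_ne_zero, by simp, by simp⟩
  have hk := hσ.algebraMap_kap A
  rw [hA, map_zero] at hk
  obtain ⟨κ, l, hκ0, hl⟩ : ∃ κ : K, ∃ l : M, κ ≠ 0 ∧ A * (A - 1) = algebraMap K M κ * l ^ 2 := by
    obtain ⟨b, hb | hb⟩ := isSquare_or_of_not_isSquare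
      (mt (hσ.isSquare_algebraMap_iff d).1 hd) (A * (A - 1))
    · exact ⟨1, b, one_ne_zero, by simpa using hb⟩
    · exact ⟨d, b, hd0, hb⟩
  have hκM : algebraMap K M κ ≠ 0 := (map_ne_zero _).2 hκ0
  have hl0 : l ≠ 0 := by
    rintro rfl
    exact mul_ne_zero hA0 (sub_ne_zero.2 hA1) (by rw [hl]; simp)
  have hl0' : σ l ≠ 0 := (map_ne_zero σ).2 hl0
  have hl0'' : σ (σ l) ≠ 0 := (map_ne_zero σ).2 hl0'
  have hl' := congrArg σ hl
  have hl'' := congrArg σ hl'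
  simp only [map_sub, map_mul, map_pow, AlgHom.commutes, map_one] at hl' hl''
  -- Since kap(A) = 0, the two sides have equal squares. The opposite sign, combined with its
  -- conjugates, would give 8κ²l²σ(l)σ²(l) = 0.
  have hE : 2 * A * σ A - A - σ A + σ (σ A) = -2 * algebraMap K M κ * l * σ l := by
    have h : (2 * A * σ A - A - σ A + σ (σ A) - 2 * algebraMap K M κ * l * σ l) *
        (2 * A * σ A - A - σ A + σ (σ A) + 2 * algebraMap K M κ * l * σ l) = 0 := by
      linear_combination -hk + 4 * (σ A) * (σ A - 1) * hl + 4 * algebraMap K M κ * l ^ 2 * hl'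
    rcases mul_eq_zero.1 h with h | h
    · exfalso
      have h' := congrArg σ h
      have h'' := congrArg σ h'
      simp only [map_add, map_sub, map_mul, AlgHom.commutes, map_ofNat, map_zero, hσ.cube]
        at h' h''
      have : 2 * 2 * 2 * (algebraMap K M κ ^ 2 * l ^ 2 * σ l * σ (σ l)) = 0 := by
        linear_combination -(2 * A - 1) * hk - 2 * algebraMap K M κ * l * σ l * h''
          - (2 * σ (σ A) * A - σ (σ A) - A + σ A) * h
          - 4 * algebraMap K M κ * σ l * σ (σ l) * hl - 2 * A * (A - 1) * h'
      simp [h2M, hκM, hl0, hl0', hl0''] at this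
    · linear_combination h
  have hE' := congrArg σ hE
  have hE'' := congrArg σ hE'
  simp only [map_add, map_sub, map_mul, AlgHom.commutes, map_ofNat, hσ.cube, map_neg]
    at hE' hE''
  have hconic : ∀ v : M, v + σ v + σ (σ v) = 0 → conic σ A (v / σ l) = 0 := by
    intro v hv
    have hu : ∀ u : M, conic σ A u =
        algebraMap K M κ * (σ l * u + σ (σ l) * σ u + l * σ (σ u)) ^ 2 := by
      intro u
      unfold conic
      linear_combination u ^ 2 * hl' + σ u ^ 2 * hl'' + σ (σ u) ^ 2 * hl - u * σ u * hE'
        - σ u * σ (σ u) * hE'' - u * σ (σ u) * hE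
    rw [hu]
    simp only [map_div₀, hσ.cube]
    rw [mul_div_cancel₀ _ hl0', mul_div_cancel₀ _ hl0'', mul_div_cancel₀ _ hl0, hv]
    simp
  -- Parametrize v = σx - x by x in M. The kernel K of this map is a spare dimension, read off by
  -- Tr(θx); an isotropic x for (form in v) - d Tr(θx)² then represents d times a square.
  obtain ⟨θ, hθ⟩ : ∃ θ, Algebra.trace K M θ = 1 := Algebra.trace_surjective K M 1
  let m : M → M →ₗ[K] M := fun x => LinearMap.mulLeft K x
  let s : M →ₗ[K] M := σ.toLinearMap
  let D : M →ₗ[K] M := s - LinearMap.id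
  let T : M →ₗ[K] M := Algebra.linearMap K M ∘ₗ Algebra.trace K M ∘ₗ m θ
  let Q : QuadraticMap K M M :=
    .linMulLin (m (σ (σ l)) ∘ₗ D) (m (σ (σ l)) ∘ₗ D)
    + .linMulLin (m ((4 * A - 2) * σ l * σ (σ l)) ∘ₗ D) (s ∘ₗ D)
    + .linMulLin (m (σ l) ∘ₗ s ∘ₗ D) (m (σ l) ∘ₗ s ∘ₗ D)
    - .linMulLin (m (algebraMap K M d) ∘ₗ T) T
  have hQ : ∀ x, Q x = (σ (σ l) * (σ x - x)) ^ 2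
      + (4 * A - 2) * σ l * σ (σ l) * (σ x - x) * (σ (σ x) - σ x)
      + (σ l * (σ (σ x) - σ x)) ^ 2 -
      algebraMap K M d * algebraMap K M (Algebra.trace K M (θ * x)) ^ 2 := by
    intro x
    simp [Q, m, s, D, T]
    ring
  obtain ⟨x, hx, h0⟩ := exists_isotropic_of_mem_range h2 hσ.finrank_eq Q (by
    intro u
    apply hσ.fixed
    rw [hQ]
    simp only [map_add, map_sub, map_mul, map_pow, map_ofNat, hσ.cube, AlgHom.commutes]
    apply mul_left_cancel₀ hκM
    linear_combination -(σ (σ u) - σ u) ^ 2 * hl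
      - ((u - σ (σ u)) ^ 2 - (σ u - u) ^ 2) * hl'' + (σ (σ u) - σ u) ^ 2 * hl'
      + (2 * σ A - 1) * (σ (σ u) - σ u) * (u - σ (σ u)) * hE''
      - (2 * A - 1) * (σ u - u) * (σ (σ u) - σ u) * hE'
      - ((σ (σ u) - σ u) ^ 2 + 2 * (σ u - u) * (σ (σ u) - σ u)) * hk)
  rw [hQ] at h0
  -- If v = 0, then x = k lies in K and Tr(θx) = k, so the form equals -dk² ≠ 0.
  have hv0 : σ x - x ≠ 0 := by
    intro hv
    obtain ⟨k, rfl⟩ := hσ.fixed x (sub_eq_zero.1 hv)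
    have : Algebra.trace K M (θ * algebraMap K M k) = k := by
      rw [mul_comm, ← Algebra.smul_def, map_smul, hθ, smul_eq_mul, mul_one]
    rw [this] at h0
    have hk0 : k ≠ 0 := by rintro rfl; simp at hx
    simp [hd0, hk0] at h0
  have hS : ((σ x - x) / σ l - σ ((σ x - x) / σ l)) ^ 2
      + 4 * A * ((σ x - x) / σ l * σ ((σ x - x) / σ l)) = algebraMap K M d *
      (algebraMap K M (Algebra.trace K M (θ * x)) / (σ l * σ (σ l))) ^ 2 := by
    generalize Algebra.trace K M (θ * x) = r at h0
    simp only [map_div₀, map_sub]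
    field_simp
    linear_combination h0
  exact hσ.solvable_of_conic h2M hd0 (div_ne_zero hv0 hl0')
    (hconic _ (by simp only [map_sub, hσ.cube]; ring)) hS

theorem IsCubicGenerator.solvable_iff [Finite K] (hσ : IsCubicGenerator σ)
    (h2 : ringChar K ≠ 2) {d : K} (hd : ¬IsSquare d) {A : M} (hA1 : A ≠ 1) :
    Solvable σ d A ↔ ¬(kap K A ≠ 0 ∧ IsSquare (kap K A)) := by
  have h2M : (2 : M) ≠ 0 := by
    rw [← map_ofNat (algebraMap K M) 2]
    exact (map_ne_zero _).2 (Ring.two_ne_zero h2)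
  have hd0 : d ≠ 0 := by rintro rfl; exact hd (by simp)
  refine ⟨fun h => ?_, fun h => ?_⟩
  · rintro ⟨h0, y, hy⟩
    obtain ⟨z, hz⟩ := hσ.isSquare_mul_kap h2M hd0 h
    have hy0 : y ≠ 0 := by rintro rfl; simp [hy] at h0
    refine hd ⟨z / y, ?_⟩
    field_simp
    linear_combination hz - d * hy
  · by_cases h0 : kap K A = 0
    · exact hσ.solvable_of_kap_eq_zero h2 hd h0 hA1
    · exact hσ.solvable_of_not_isSquare h2 hd fun h' => h ⟨h0, h'⟩

end


/-! ### Counting the nonzero square values of kap -/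

/-- Nonzero squares. -/
def IsNonzeroSquare {F : Type*} [Field F] (x : F) : Prop := x ≠ 0 ∧ IsSquare x

theorem isNonzeroSquare_sq_mul {F : Type*} [Field F] {c : F} (hc : c ≠ 0) (x : F) :
    IsNonzeroSquare (c ^ 2 * x) ↔ IsNonzeroSquare x := by
  unfold IsNonzeroSquare
  refine and_congr (by simp [hc]) ⟨?_, fun h => (IsSquare.sq c).mul h⟩
  rintro ⟨y, hy⟩
  exact ⟨y / c, by field_simp; linear_combination hy⟩

section

open Classical Finset

theorem card_isNonzeroSquare (F : Type*) [Field F] [Fintype F] (h2 : ringChar F ≠ 2) :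
    2 * #{x : F | IsNonzeroSquare x} + 1 = Fintype.card F := by
  have h1 : #{x : F | IsNonzeroSquare x} = #{x : F | quadraticChar F x = 1} := by
    refine congrArg card (filter_congr fun x _ => ?_)
    by_cases hx : x = 0
    · rw [hx, quadraticChar_zero]
      simp [IsNonzeroSquare]
    · rw [quadraticChar_one_iff_isSquare hx, IsNonzeroSquare, and_iff_right hx]
  have h0 : #{x : F | quadraticChar F x = 0} = 1 := by
    rw [filter_congr fun x _ => quadraticChar_eq_zero_iff]
    exact card_eq_one.2 ⟨0, by ext; simp⟩
  have hs := quadraticChar_sum_zero h2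
  have hv : ∀ x : F, quadraticChar F x = (if quadraticChar F x = 1 then 1 else 0)
      - (if quadraticChar F x = -1 then 1 else 0) := by
    intro x
    by_cases hx : x = 0
    · simp [hx]
    · rcases quadraticChar_dichotomy hx with h | h <;> simp [h]
  have hc : ∀ x : F, (1 : ℤ) = (if quadraticChar F x = 1 then 1 else 0)
      + (if quadraticChar F x = -1 then 1 else 0) + (if quadraticChar F x = 0 then 1 else 0) := by
    intro x
    by_cases hx : x = 0
    · simp [hx]
    · rcases quadraticChar_dichotomy hx with h | h <;> simp [h]
  rw [sum_congr rfl fun x _ => hv x, sum_sub_distrib] at hs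
  have hs' : ∑ _x : F, (1 : ℤ) = _ := sum_congr rfl fun x _ => hc x
  rw [sum_add_distrib, sum_add_distrib] at hs'
  simp only [sum_boole, sum_const, card_univ, nsmul_eq_mul, mul_one] at hs hs'
  rw [h0] at hs'
  rw [h1]
  omega

theorem card_isNonzeroSquare_affine {F : Type*} [Field F] [Fintype F] (a : F) {b : F}
    (hb : b ≠ 0) : #{z : F | IsNonzeroSquare (a + b * z)} = #{x : F | IsNonzeroSquare x} :=
  card_bijective (fun z => a + b * z)
    ((Equiv.addLeft a).bijective.comp (mulLeft_bijective₀ b hb)) (by simp)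

/-- For x ≠ 0 the discriminant is affine in z with nonzero slope; for x = 0 it is y². -/
theorem card_discrim_isNonzeroSquare (F : Type*) [Field F] [Fintype F] (h2 : ringChar F ≠ 2) :
    2 * #{v : F × F × F | IsNonzeroSquare (v.2.1 ^ 2 - 4 * v.1 * v.2.2)} =
      (Fintype.card F - 1) * Fintype.card F * (Fintype.card F + 1) := by
  have h4 : (4 : F) ≠ 0 := by
    have : (4 : F) = 2 * 2 := by norm_num
    rw [this]
    exact mul_ne_zero (Ring.two_ne_zero h2) (Ring.two_ne_zero h2)
  have hn := card_isNonzeroSquare F h2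
  set n := #{x : F | IsNonzeroSquare x}
  set q := Fintype.card F
  have hcard : #{v : F × F × F | IsNonzeroSquare (v.2.1 ^ 2 - 4 * v.1 * v.2.2)} =
      ∑ x : F, ∑ y : F, #{z : F | IsNonzeroSquare (y ^ 2 - 4 * x * z)} := by
    rw [card_filter, Fintype.sum_prod_type]
    refine sum_congr rfl fun x _ => ?_
    rw [Fintype.sum_prod_type]
    exact sum_congr rfl fun y _ => (card_filter _ _).symm
  have h1 : ∀ x : F, x ≠ 0 → ∑ y : F, #{z : F | IsNonzeroSquare (y ^ 2 - 4 * x * z)} = q * n := by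
    intro x hx
    have : ∀ y : F, #{z : F | IsNonzeroSquare (y ^ 2 - 4 * x * z)} = n := by
      intro y
      rw [show n = _ from
        (card_isNonzeroSquare_affine (y ^ 2) (neg_ne_zero.2 (mul_ne_zero h4 hx))).symm]
      simp only [neg_mul, ← sub_eq_add_neg]
    simp [this, q]
  have h0 : ∑ y : F, #{z : F | IsNonzeroSquare (y ^ 2 - 4 * 0 * z)} = (q - 1) * q := by
    have : ∀ y : F, #{z : F | IsNonzeroSquare (y ^ 2 - 4 * 0 * z)} = if y = 0 then 0 else q := by
      intro y
      have e : ∀ z : F, IsNonzeroSquare (y ^ 2 - 4 * 0 * z) ↔ y ≠ 0 := by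
        intro z
        simp [IsNonzeroSquare, IsSquare.sq]
      simp only [e]
      split_ifs with hy <;> simp [hy, q]
    simp only [this]
    rw [← sum_erase_add _ _ (mem_univ (0 : F)), if_pos rfl, add_zero,
      sum_congr rfl fun y hy => if_neg (ne_of_mem_erase hy), sum_const,
      card_erase_of_mem (mem_univ _), card_univ, smul_eq_mul]
  rw [hcard, ← sum_erase_add _ _ (mem_univ (0 : F)), h0,
    sum_congr rfl fun x hx => h1 x (ne_of_mem_erase hx), sum_const,
      card_erase_of_mem (mem_univ _), card_univ, smul_eq_mul]
  change 2 * ((q - 1) * (q * n) + (q - 1) * q) = _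
  rw [← hn]
  ring

variable {K M : Type*} [Field K] [Field M] [Algebra K M] {σ : M →ₐ[K] M}

theorem IsCubicGenerator.exists_ne (hσ : IsCubicGenerator σ) :
    ∃ s : M, σ s ≠ s := by
  by_contra! h
  have : Function.Surjective (algebraMap K M) := fun x => hσ.fixed x (h x)
  have := (LinearEquiv.ofBijective (Algebra.linearMap K M)
    ⟨(algebraMap K M).injective, this⟩).finrank_eq
  rw [hσ.finrank_eq, Module.finrank_self] at this
  omega

theorem IsCubicGenerator.card_traceForm_isNonzeroSquare [Fintype K] [Fintype M]
    (hσ : IsCubicGenerator σ) (h2 : ringChar K ≠ 2) :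
    2 * #{B : M | IsNonzeroSquare (2 * Algebra.trace K M (B ^ 2) - Algebra.trace K M B ^ 2)} =
      (Fintype.card K - 1) * Fintype.card K * (Fintype.card K + 1) := by
  rw [← card_discrim_isNonzeroSquare K h2]
  congr 1
  obtain ⟨s, hs⟩ := hσ.exists_ne
  have hs2 : σ (σ s) ≠ s := by
    intro h
    have := congrArg σ h
    rw [hσ.cube] at this
    exact hs this.symm
  have hs3 : σ (σ s) ≠ σ s := fun h => hs (σ.injective h)
  have he : σ s - s ≠ 0 := sub_ne_zero.2 hs
  -- Lagrange interpolation: the conjugates of e = s + σs are distinct, and σs - s is the difference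
  -- of the other two. For B = (σs - s)² p(e) with p = x + yX + zX², the form at B is δ² disc(p),
  -- where δ is the product of the differences.
  let φ : K × K × K → M := fun v => (σ s - s) ^ 2 * (algebraMap K M v.1 +
    algebraMap K M v.2.1 * (s + σ s) + algebraMap K M v.2.2 * (s + σ s) ^ 2)
  have hφ : ∀ x y z : K, algebraMap K M x + algebraMap K M y * (s + σ s)
      + algebraMap K M z * (s + σ s) ^ 2 = 0 → x = 0 ∧ y = 0 ∧ z = 0 := by
    intro x y z h₁
    have h₂ := congrArg σ h₁
    have h₃ := congrArg σ h₂
    simp only [map_add, map_mul, map_pow, AlgHom.commutes, hσ.cube, map_zero] at h₂ h₃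
    have e₁ : algebraMap K M y + algebraMap K M z * (s + 2 * σ s + σ (σ s)) = 0 := by
      apply mul_left_cancel₀ (sub_ne_zero.2 hs2)
      linear_combination h₂ - h₁
    have e₂ : algebraMap K M y + algebraMap K M z * (σ s + 2 * σ (σ s) + s) = 0 := by
      apply mul_left_cancel₀ he
      linear_combination h₂ - h₃
    have hz : z = 0 := by
      have : algebraMap K M z * (σ (σ s) - σ s) = 0 := by linear_combination e₂ - e₁
      exact (map_eq_zero _).1 ((mul_eq_zero.1 this).resolve_right (sub_ne_zero.2 hs3))
    have hy : y = 0 := by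
      rw [hz, map_zero, zero_mul, add_zero] at e₁
      exact (map_eq_zero _).1 e₁
    rw [hy, hz] at h₁
    simp only [map_zero, zero_mul, add_zero] at h₁
    exact ⟨(map_eq_zero _).1 h₁, hy, hz⟩
  have hinj : Function.Injective φ := by
    rintro ⟨x, y, z⟩ ⟨x', y', z'⟩ h
    have h' := mul_left_cancel₀ (pow_ne_zero 2 he) h
    obtain ⟨hx, hy, hz⟩ := hφ (x - x') (y - y') (z - z') (by
      simp only [map_sub]
      linear_combination h')
    rw [sub_eq_zero.1 hx, sub_eq_zero.1 hy, sub_eq_zero.1 hz]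
  have hbij : Function.Bijective φ := by
    rw [Fintype.bijective_iff_injective_and_card]
    refine ⟨hinj, ?_⟩
    rw [Module.card_eq_pow_finrank (K := K) (V := M), hσ.finrank_eq, Fintype.card_prod,
      Fintype.card_prod]
    ring
  obtain ⟨δ, hδ⟩ := hσ.fixed ((σ s - s) * (σ (σ s) - σ s) * (s - σ (σ s))) (by
    simp only [map_mul, map_sub, hσ.cube]
    ring)
  have hδ0 : δ ≠ 0 := by
    rintro rfl
    rw [map_zero] at hδ
    exact mul_ne_zero (mul_ne_zero he (sub_ne_zero.2 hs3)) (sub_ne_zero.2 hs2.symm) hδ.symm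
  refine (card_bijective φ hbij ?_).symm
  rintro ⟨x, y, z⟩
  simp only [mem_filter, mem_univ, true_and]
  rw [← isNonzeroSquare_sq_mul hδ0]
  refine iff_of_eq (congrArg _ ?_)
  apply (algebraMap K M).injective
  simp only [φ, map_sub, map_mul, map_pow, hδ, hσ.trace_eq, map_ofNat, map_add, AlgHom.commutes,
    hσ.cube]
  ring

/-- Count pairs (l, B) of nonzero elements with kap(lB) a nonzero square. Each l contributes the
desired number G. Each B contributes (q - 1)/2, less one if the missing value l = 0 of h(B) + 4N(B)l
gives a nonzero square. -/
theorem IsCubicGenerator.card_kap_isNonzeroSquare [Fintype K] [Fintype M]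
    (hσ : IsCubicGenerator σ) (h2 : ringChar K ≠ 2) :
    2 * #{A : M | IsNonzeroSquare (kap K A)} + Fintype.card K ^ 2 + Fintype.card K + 1 =
      Fintype.card K ^ 3 := by
  have h4 : (4 : K) ≠ 0 := by
    have : (4 : K) = 2 * 2 := by norm_num
    rw [this]
    exact mul_ne_zero (Ring.two_ne_zero h2) (Ring.two_ne_zero h2)
  have hn := card_isNonzeroSquare K h2
  have hH := hσ.card_traceForm_isNonzeroSquare h2
  set n := #{x : K | IsNonzeroSquare x}
  have hM : Fintype.card M = Fintype.card K ^ 3 := by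
    rw [Module.card_eq_pow_finrank (K := K) (V := M), hσ.finrank_eq]
  have hq : 1 < Fintype.card K := Fintype.one_lt_card
  set q := Fintype.card K
  set G := #{A : M | IsNonzeroSquare (kap K A)}
  set h : M → K := fun B => 2 * Algebra.trace K M (B ^ 2) - Algebra.trace K M B ^ 2
  have hk : ∀ (l : K) (B : M), kap K (l • B) = l ^ 2 * (h B + 4 * Algebra.norm K B * l) := by
    intro l B
    have : Algebra.norm K (l • B) = l ^ 3 * Algebra.norm K B := by
      rw [Algebra.smul_def, map_mul, Algebra.norm_algebraMap, hσ.finrank_eq]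
    simp only [kap, h, this, smul_pow, map_smul, smul_eq_mul]
    ring
  have h0 : ¬ IsNonzeroSquare (kap K (0 : M)) := by simp [kap, IsNonzeroSquare]
  have hcol : ∀ l ∈ univ.erase (0 : K),
      ∑ B ∈ univ.erase (0 : M), (if IsNonzeroSquare (kap K (l • B)) then 1 else 0) = G := by
    intro l hl
    have hl' : l ≠ 0 := ne_of_mem_erase hl
    rw [sum_erase _ (by simp [h0]), ← card_filter]
    exact card_bijective (fun B => l • B) (MulAction.bijective₀ hl') (by simp)
  have hrow : ∀ B ∈ univ.erase (0 : M),
      ∑ l ∈ univ.erase (0 : K), (if IsNonzeroSquare (kap K (l • B)) then 1 else 0) +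
        (if IsNonzeroSquare (h B) then 1 else 0) = n := by
    intro B hB
    have hB' : Algebra.norm K B ≠ 0 := by
      have : Module.Finite K M := Module.finite_of_finrank_pos (by rw [hσ.finrank_eq]; norm_num)
      exact Algebra.norm_ne_zero_iff.2 (ne_of_mem_erase hB)
    rw [show n = _ from (card_isNonzeroSquare_affine (h B) (mul_ne_zero h4 hB')).symm,
      card_filter, ← sum_erase_add _ _ (mem_univ (0 : K)), mul_zero, add_zero]
    congr 1
    refine sum_congr rfl fun l hl => ?_
    rw [hk, isNonzeroSquare_sq_mul (ne_of_mem_erase hl)]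
  have hsum := sum_congr rfl hrow
  rw [sum_add_distrib, sum_comm, sum_congr rfl hcol, sum_const, sum_const,
    sum_erase _ (by simp [h, IsNonzeroSquare]), ← card_filter,
    card_erase_of_mem (mem_univ _), card_erase_of_mem (mem_univ _), card_univ, card_univ, hM,
    smul_eq_mul, smul_eq_mul] at hsum
  change (q - 1) * G + #{B : M | IsNonzeroSquare (h B)} = (q ^ 3 - 1) * n at hsum
  have hq3 : 1 ≤ q ^ 3 := Nat.one_le_pow _ _ (by omega)
  obtain ⟨r, hr⟩ : ∃ r, q = r + 1 := ⟨q - 1, by omega⟩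
  have hr0 : 0 < r := by omega
  zify [hq.le, hq3] at *
  have : (r : ℤ) * (2 * G + q ^ 2 + q + 1) = r * q ^ 3 := by
    have hr' : (r : ℤ) = q - 1 := by linarith
    rw [hr']
    linear_combination 2 * hsum - hH + (q ^ 3 - 1 : ℤ) * hn
  exact mul_left_cancel₀ hr0.ne' this

end


/-! ### From scatteredness to a norm equation -/

theorem mem_range_of_pow_card_eq {F E : Type*} [Field F] [Fintype F] [Field E]
    [Finite E] [Algebra F E] {x : E} (hx : x ^ Fintype.card F = x) : ∃ k, algebraMap F E k = x := by
  have := Module.Finite.of_finite (R := F) (M := E)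
  refine (IsGalois.mem_range_algebraMap_iff_fixed x).2 fun f => ?_
  obtain ⟨i, rfl⟩ := (FiniteField.bijective_frobeniusAlgEquivOfAlgebraic_pow F E).2 f
  rw [AlgEquiv.coe_pow, FiniteField.coe_frobeniusAlgEquivOfAlgebraic]
  exact Function.iterate_fixed hx _

theorem isCubicGenerator_frobenius {K M : Type*} [Field K] [Fintype K] [Field M] [Algebra K M]
    (h : Module.finrank K M = 3) : IsCubicGenerator (FiniteField.frobeniusAlgHom K M) := by
  have : Module.Finite K M := Module.finite_of_finrank_pos (by rw [h]; norm_num)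
  have : Finite M := Module.finite_of_finite K
  have := Fintype.ofFinite M
  have hc : Fintype.card M = Fintype.card K ^ 3 := by
    rw [Module.card_eq_pow_finrank (K := K) (V := M), h]
  refine ⟨h, fun x => ?_, fun x hx => mem_range_of_pow_card_eq hx, fun x => ?_,
    fun x => ?_⟩
  · simp only [FiniteField.coe_frobeniusAlgHom, ← pow_mul]
    rw [← pow_three', ← hc, FiniteField.pow_card]
  · rw [FiniteField.algebraMap_trace_eq_sum_pow, h]
    simp [Finset.sum_range_succ, ← pow_mul, ← pow_two]
  · rw [FiniteField.algebraMap_norm_eq_prod_pow, h]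
    simp [Finset.prod_range_succ, ← pow_mul, ← pow_two]

section

variable {K L : Type*} [Field K] [Field L] [Algebra K L]

/-- The map `x ↦ b x^q + x^(q^4)` for an algebra endomorphism `φ` in place of `x ↦ x^q`. -/
noncomputable def binomialMap (φ : L →ₐ[K] L) (b : L) : L →ₗ[K] L :=
  LinearMap.mulLeft K b ∘ₗ φ.toLinearMap + (φ ^ 4).toLinearMap

theorem binomialMap_apply (φ : L →ₐ[K] L) (b x : L) :
    binomialMap φ b x = b * φ x + φ (φ (φ (φ x))) := rfl

theorem U_eq_range [Fintype K] (b : L) : U K b =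
    (LinearMap.id.prod (binomialMap (FiniteField.frobeniusAlgHom K L) b)).range := by
  have h : ∀ x : L, x ^ Fintype.card K ^ 4 =
      (((x ^ Fintype.card K) ^ Fintype.card K) ^ Fintype.card K) ^ Fintype.card K := fun x => by
    rw [← pow_mul, ← pow_mul, ← pow_mul]
    ring_nf
  ext p
  change (∃ x : L, p = (x, b * x ^ Fintype.card K + x ^ Fintype.card K ^ 4)) ↔ ∃ x : L,
    (x, b * x ^ Fintype.card K +
      (((x ^ Fintype.card K) ^ Fintype.card K) ^ Fintype.card K) ^ Fintype.card K) = p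
  simp only [h, eq_comm]

/-- Nonzero graph vectors on one L-line have the form (x, f x) and z(x, f x); they are K-dependent
exactly when z is in K. -/
theorem isScattered_graph_iff [FiniteDimensional K L] (f : L →ₗ[K] L) :
    IsScattered K L (LinearMap.id.prod f).range ↔
      ∀ x z : L, x ≠ 0 → f (z * x) = z * f x → ∃ k, algebraMap K L k = z := by
  constructor
  · intro h x z hx hz
    have hv : ((x, f x) : L × L) ≠ 0 := fun h => hx (congrArg Prod.fst h)
    obtain ⟨w, hw⟩ := finrank_le_one_iff.1 (h (x, f x) hv)
    obtain ⟨c, hc⟩ := hw ⟨(x, f x), ⟨x, rfl⟩, Submodule.mem_span_singleton_self _⟩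
    obtain ⟨c', hc'⟩ := hw ⟨(z * x, f (z * x)), ⟨z * x, rfl⟩, by
      rw [hz]
      exact Submodule.mem_span_singleton.2 ⟨z, rfl⟩⟩
    have e : c • (w : L × L).1 = x := congrArg (fun y => y.1.1) hc
    have e' : c' • (w : L × L).1 = z * x := congrArg (fun y => y.1.1) hc'
    have hc0 : c ≠ 0 := by rintro rfl; rw [zero_smul] at e; exact hx e.symm
    refine ⟨c' / c, mul_right_cancel₀ hx ?_⟩
    have h' := congrArg ((c' / c) • ·) e
    simp only [smul_smul, div_mul_cancel₀ _ hc0] at h'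
    rw [← Algebra.smul_def, ← e', ← h']
  · intro h v hv
    by_cases hW : ∀ w : ((LinearMap.id.prod f).range ⊓
        (Submodule.span L {v}).restrictScalars K : Submodule K (L × L)), w = 0
    · exact finrank_le_one 0 fun w => ⟨0, by rw [hW w, smul_zero]⟩
    push Not at hW
    obtain ⟨⟨_, ⟨x, rfl⟩, hw⟩, hw0⟩ := hW
    refine finrank_le_one ⟨_, ⟨x, rfl⟩, hw⟩ ?_
    rintro ⟨_, ⟨y, rfl⟩, hw'⟩
    have hx : x ≠ 0 := by
      rintro rfl
      exact hw0 (Subtype.ext (map_zero _))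
    obtain ⟨α, hα⟩ := Submodule.mem_span_singleton.1 hw
    obtain ⟨β, hβ⟩ := Submodule.mem_span_singleton.1 hw'
    have e₁ : α * v.1 = x := congrArg Prod.fst hα
    have e₂ : α * v.2 = f x := congrArg Prod.snd hα
    have e₃ : β * v.1 = y := congrArg Prod.fst hβ
    have e₄ : β * v.2 = f y := congrArg Prod.snd hβ
    have hα0 : α ≠ 0 := by rintro rfl; rw [zero_mul] at e₁; exact hx e₁.symm
    have hy : β / α * x = y := by rw [← e₁, ← e₃]; field_simp
    obtain ⟨k, hk⟩ := h x (β / α) hx (by rw [hy, ← e₂, ← e₄]; field_simp)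
    refine ⟨k, Subtype.ext ?_⟩
    have : k • x = y := by rw [Algebra.smul_def, hk, hy]
    change k • (LinearMap.id.prod f) x = (LinearMap.id.prod f) y
    rw [← map_smul, this]

theorem isMaximumScattered_U_iff [Fintype K] [FiniteDimensional K L] (b : L) :
    IsMaximumScattered K L (U K b) ↔ IsScattered K L (U K b) := by
  refine and_iff_left ?_
  rw [U_eq_range, LinearMap.finrank_range_of_inj fun x y h => congrArg Prod.fst h,
    Module.finrank_prod, Module.finrank_self]

/-- Existence of `x` with prescribed ratio reduces to an equation between relative norms. -/
theorem exists_binomialMap_mul_eq_iff {φ : L →ₐ[K] L}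
    (h6 : ∀ x, φ (φ (φ (φ (φ (φ x))))) = x) {ω : L} (hω0 : ω ≠ 0) (hω : φ ω = -ω) {b z : L}
    (hz : φ z ≠ z) :
    (∃ x ≠ 0, binomialMap φ b (z * x) = z * binomialMap φ b x) ↔
      b * φ (φ (φ b)) * ((φ z - z) * φ (φ (φ (φ z - z)))) =
        (φ (φ (φ (φ z))) - z) * φ (φ (φ (φ (φ (φ (φ z))) - z))) := by
  simp only [binomialMap_apply, map_mul, map_sub, h6]
  constructor
  · rintro ⟨x, hx, h⟩
    have hx' : φ x ≠ 0 := (map_ne_zero φ).2 hx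
    have hx'' : φ (φ (φ (φ x))) ≠ 0 := by simpa using hx
    have h' := congrArg (fun y => φ (φ (φ y))) h
    simp only [map_mul, map_add, h6] at h'
    have h₁ : b * φ x * (φ z - z) = -(φ (φ (φ (φ x))) * (φ (φ (φ (φ z))) - z)) := by
      linear_combination h
    have h₂ := congrArg (fun y => φ (φ (φ y))) h₁
    simp only [map_mul, map_sub, map_neg, h6] at h₂
    apply mul_left_cancel₀ (mul_ne_zero hx' hx'')
    linear_combination φ (φ (φ b)) * φ (φ (φ (φ x))) * (φ (φ (φ (φ z))) - φ (φ (φ z))) * h₁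
      - φ (φ (φ (φ x))) * (φ (φ (φ (φ z))) - z) * h₂
  · intro h
    have hz0 : φ z - z ≠ 0 := sub_ne_zero.2 hz
    have hz3 : φ (φ (φ (φ z))) - φ (φ (φ z)) ≠ 0 := by
      rw [← map_sub, ← map_sub, ← map_sub]
      exact (map_ne_zero φ).2 ((map_ne_zero φ).2 ((map_ne_zero φ).2 hz0))
    by_cases hz4 : φ (φ (φ (φ z))) = z
    · have hb : b = 0 := by
        have h' : b * φ (φ (φ b)) * ((φ z - z) * (φ (φ (φ (φ z))) - φ (φ (φ z)))) = 0 := by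
          rw [h, hz4]; ring
        have := (mul_eq_zero.1 h').resolve_right (mul_ne_zero hz0 hz3)
        simpa using this
      exact ⟨1, one_ne_zero, by simp [hb, hz4]⟩
    have hw : z - φ (φ (φ (φ z))) ≠ 0 := sub_ne_zero.2 (Ne.symm hz4)
    have hw3 : φ (φ (φ z)) - φ z ≠ 0 := by
      have := (map_ne_zero (φ ^ 3)).2 hw
      simpa [pow_succ, h6] using this
    -- With y = φ x the equation reads φ³y = βy, and the norm equation says βφ³(β) = 1, as Hilbert
    -- 90 for the involution φ³ requires.
    set β := b * (φ z - z) / (z - φ (φ (φ (φ z)))) with hβ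
    have hβ3 : φ (φ (φ β)) =
        φ (φ (φ b)) * (φ (φ (φ (φ z))) - φ (φ (φ z))) / (φ (φ (φ z)) - φ z) := by
      simp [hβ, h6]
    have hβn : β * φ (φ (φ β)) = 1 := by
      rw [hβ3, hβ]
      field_simp
      linear_combination h
    obtain ⟨y, hy, hyβ⟩ : ∃ y ≠ 0, φ (φ (φ y)) = β * y := by
      -- The usual solution 1 + φ³(β) vanishes only for β = -1, where ω serves because φ³ω = -ω.
      by_cases h1 : β = -1
      · exact ⟨ω, hω0, by rw [h1]; simp [hω]⟩
      · refine ⟨1 + φ (φ (φ β)), fun h0 => h1 ?_, by simp [h6, mul_add, hβn, add_comm]⟩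
        have := congrArg (β * ·) h0
        simp only [mul_add, hβn, mul_zero] at this
        linear_combination this
    -- This is φ⁻¹(y), as φ⁶ = 1.
    refine ⟨φ (φ (φ (φ (φ y)))), by simpa using hy, ?_⟩
    simp only [h6]
    have e : β * (z - φ (φ (φ (φ z)))) = b * (φ z - z) := div_mul_cancel₀ _ hw
    linear_combination -y * e - (z - φ (φ (φ (φ z)))) * hyβ

end


/-! ### Coordinates over the cubic subfield -/

section

variable {K M L : Type*} [Field K] [Field M] [Field L] [Algebra K M] [Algebra M L] [Algebra K L]
  [IsScalarTower K M L]

/-- The norm equation in coordinates `z = s + t ω` with `ω ^ 2 = d`. -/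
def IsBadNorm (σ : M →ₐ[K] M) (d : K) (w : M) : Prop :=
  ∃ s t : M, ¬(σ s = s ∧ t = 0) ∧
    w * ((σ s - s) ^ 2 - algebraMap K M d * (σ t + t) ^ 2) =
      (σ s - s) ^ 2 - algebraMap K M d * (σ t - t) ^ 2

theorem IsCubicGenerator.isBadNorm_one {σ : M →ₐ[K] M} (hσ : IsCubicGenerator σ) (d : K) :
    IsBadNorm σ d 1 := by
  obtain ⟨s, hs⟩ := hσ.exists_ne
  exact ⟨s, 0, fun h => hs h.1, by simp⟩

/-- Additive Hilbert 90. -/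
theorem IsCubicGenerator.exists_sub_eq [Finite M] {σ : M →ₐ[K] M} (hσ : IsCubicGenerator σ) {a : M}
    (ha : a + σ a + σ (σ a) = 0) : ∃ s, σ s - s = a := by
  have : Finite K := Finite.of_injective _ (algebraMap K M).injective
  obtain ⟨θ, hθ⟩ : ∃ θ, Algebra.trace K M θ = 1 := Algebra.trace_surjective K M 1
  have h := hσ.trace_eq θ
  rw [hθ, map_one] at h
  refine ⟨-(a * σ θ + (a + σ a) * σ (σ θ)), ?_⟩
  simp only [map_neg, map_add, map_mul, hσ.cube]
  linear_combination -a * h - θ * ha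

theorem IsCubicGenerator.isBadNorm_iff_solvable [Finite M] {σ : M →ₐ[K] M}
    (hσ : IsCubicGenerator σ) (d : K) {w : M} (hw : w ≠ 1) :
    IsBadNorm σ d w ↔ Solvable σ d (w / (w - 1)) := by
  have hw' : w - 1 ≠ 0 := sub_ne_zero.2 hw
  constructor
  · rintro ⟨s, t, hst, h⟩
    refine ⟨σ s - s, t, ?_, by simp only [map_sub, hσ.cube]; ring, ?_⟩
    · rintro rfl
      refine hst ⟨?_, rfl⟩
      simp only [map_zero, add_zero, sub_zero, ne_eq, OfNat.ofNat_ne_zero, not_false_eq_true,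
        zero_pow, mul_zero] at h
      have : (w - 1) * (σ s - s) ^ 2 = 0 := by linear_combination h
      exact sub_eq_zero.1 (pow_eq_zero_iff two_ne_zero |>.1 ((mul_eq_zero.1 this).resolve_left hw'))
    · field_simp
      linear_combination h
  · rintro ⟨a, t, ht, ha, h⟩
    obtain ⟨s, rfl⟩ := hσ.exists_sub_eq ha
    refine ⟨s, t, fun h => ht h.2, ?_⟩
    field_simp at h
    linear_combination h

theorem exists_sq_eq_algebraMap [Fintype K] [Finite L] (hKL : Even (Module.finrank K L))
    (h2 : ringChar K ≠ 2) (d : K) : ∃ ω : L, ω ^ 2 = algebraMap K L d := by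
  have := Fintype.ofFinite L
  have : Module.Finite K L := Module.Finite.of_finite
  rcases eq_or_ne d 0 with rfl | hd
  · exact ⟨0, by simp⟩
  have h2L : ringChar L ≠ 2 := by rwa [Algebra.ringChar_eq K L] at h2
  suffices h : IsSquare (algebraMap K L d) by
    obtain ⟨ω, hω⟩ := h
    exact ⟨ω, by rw [hω, pow_two]⟩
  rw [FiniteField.isSquare_iff h2L ((map_ne_zero _).2 hd), ← map_pow]
  obtain ⟨n, hn⟩ := hKL
  -- With q = |K|, 2(q - 1) divides q² - 1, which divides |L| - 1; so d^((|L| - 1)/2) = 1 and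
  -- Euler's criterion applies.
  obtain ⟨m, hm⟩ : Fintype.card K ^ 2 - 1 ∣ Fintype.card L - 1 := by
    rw [Module.card_eq_pow_finrank (K := K) (V := L), hn, ← two_mul, pow_mul]
    exact Nat.sub_one_dvd_pow_sub_one _ _
  obtain ⟨r, hr⟩ : ∃ r, Fintype.card K = 2 * r + 1 :=
    ⟨Fintype.card K / 2, by have := FiniteField.odd_card_of_char_ne_two h2; omega⟩
  have hodd := FiniteField.odd_card_of_char_ne_two h2L
  have e : Fintype.card K ^ 2 - 1 = 2 * ((Fintype.card K - 1) * (r + 1)) := by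
    rw [hr, Nat.add_sub_cancel, Nat.sub_eq_iff_eq_add (Nat.one_le_pow _ _ (by omega))]
    ring
  have : Fintype.card L / 2 = (Fintype.card K - 1) * ((r + 1) * m) := by
    rw [e, mul_assoc, mul_assoc] at hm
    omega
  rw [this, pow_mul, FiniteField.pow_card_sub_one_eq_one d hd, one_pow, map_one]

theorem isMaximumScattered_U_iff_not_isBadNorm [Fintype K]
    (hKM : Module.finrank K M = 3) (hKL : Module.finrank K L = 6)
    (h2 : ringChar K ≠ 2) {d : K} (hd : ¬IsSquare d) (b : L) :
    IsMaximumScattered K L (U K b) ↔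
      ¬ IsBadNorm (FiniteField.frobeniusAlgHom K M) d (Algebra.norm M b) := by
  have : Module.Finite K L := Module.finite_of_finrank_pos (by rw [hKL]; norm_num)
  have : Module.Finite K M := Module.finite_of_finrank_pos (by rw [hKM]; norm_num)
  have : Finite L := Module.finite_of_finite K
  have : Finite M := Module.finite_of_finite K
  have := Fintype.ofFinite M
  have := Fintype.ofFinite L
  have hML : Module.finrank M L = 2 := by
    have := Module.finrank_mul_finrank K M L
    rw [hKM, hKL] at this
    omega
  have hσ := isCubicGenerator_frobenius hKM
  set σ := FiniteField.frobeniusAlgHom K M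
  set φ := FiniteField.frobeniusAlgHom K L with hφ
  have h2L : (2 : L) ≠ 0 := by
    rw [← map_ofNat (algebraMap K L) 2]
    exact (map_ne_zero _).2 (Ring.two_ne_zero h2)
  have hcM : Fintype.card M = Fintype.card K ^ 3 := by
    rw [Module.card_eq_pow_finrank (K := K) (V := M), hKM]
  have hcL : Fintype.card L = Fintype.card K ^ 6 := by
    rw [Module.card_eq_pow_finrank (K := K) (V := L), hKL]
  have hφ3 : ∀ x, φ (φ (φ x)) = x ^ Fintype.card M := by
    intro x
    simp only [hφ, FiniteField.coe_frobeniusAlgHom, ← pow_mul]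
    rw [hcM, pow_three']
  have h6 : ∀ x, φ (φ (φ (φ (φ (φ x))))) = x := by
    intro x
    rw [hφ3 x, hφ3, hcM, ← pow_mul, ← pow_add, ← hcL, FiniteField.pow_card]
  have hφM : ∀ s : M, φ (algebraMap M L s) = algebraMap M L (σ s) := fun s => (map_pow _ _ _).symm
  have hnorm : ∀ x : L, algebraMap M L (Algebra.norm M x) = x * φ (φ (φ x)) := by
    intro x
    rw [FiniteField.algebraMap_norm_eq_prod_pow, hML, hφ3]
    simp [Finset.prod_range_succ]
  have hfix : ∀ x : L, φ (φ (φ x)) = x → ∃ s, algebraMap M L s = x := fun x hx =>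
    mem_range_of_pow_card_eq (by rw [← hφ3, hx])
  have hfixK : ∀ x : L, φ x = x ↔ ∃ k, algebraMap K L k = x :=
    fun x => ⟨mem_range_of_pow_card_eq, by rintro ⟨k, rfl⟩; exact φ.commutes k⟩
  obtain ⟨ω, hω⟩ := exists_sq_eq_algebraMap (L := L) (by rw [hKL]; decide) h2 d
  have hω0 : ω ≠ 0 := by
    rintro rfl
    refine hd ⟨0, (algebraMap K L).injective ?_⟩
    rw [← hω]; simp
  have hφω : φ ω = -ω := by
    have h := congrArg φ hω
    rw [map_pow, AlgHom.commutes, ← hω] at h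
    refine (sq_eq_sq_iff_eq_or_eq_neg.1 h).resolve_left fun h' => ?_
    obtain ⟨k, rfl⟩ := (hfixK ω).1 h'
    refine hd ⟨k, (algebraMap K L).injective ?_⟩
    rw [← hω, map_mul, pow_two]
  rw [isMaximumScattered_U_iff, U_eq_range, isScattered_graph_iff, ← hφ, IsBadNorm]
  have hML' : algebraMap K L d = algebraMap M L (algebraMap K M d) :=
    IsScalarTower.algebraMap_apply K M L d
  have hcoord : ∀ s t : M, ∀ z, z = algebraMap M L s + algebraMap M L t * ω →
      ((b * φ (φ (φ b)) * ((φ z - z) * φ (φ (φ (φ z - z)))) =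
        (φ (φ (φ (φ z))) - z) * φ (φ (φ (φ (φ (φ (φ z))) - z)))) ↔
      Algebra.norm M b * ((σ s - s) ^ 2 - algebraMap K M d * (σ t + t) ^ 2) =
      (σ s - s) ^ 2 - algebraMap K M d * (σ t - t) ^ 2) := by
    rintro s t z rfl
    rw [← (algebraMap M L).injective.eq_iff, ← hnorm]
    simp only [map_add, map_sub, map_mul, map_pow, map_neg, hφM, hφω, hσ.cube]
    rw [← hML', ← hω]
    refine iff_of_eq (congrArg₂ _ ?_ ?_) <;> ring
  have hz : ∀ s t : M, φ (algebraMap M L s + algebraMap M L t * ω) =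
      algebraMap M L s + algebraMap M L t * ω ↔ (σ s = s ∧ t = 0) := by
    intro s t
    rw [map_add, map_mul, hφM, hφM, hφω]
    constructor
    · intro h
      have h₁ : algebraMap M L (σ s - s) = algebraMap M L (σ t + t) * ω := by
        simp only [map_sub, map_add]
        linear_combination h
      -- φ³ fixes M and negates ω, so both sides vanish. Then σt = -t, and σ³ = 1 forces t = 0.
      have h₂ := congrArg (fun x => φ (φ (φ x))) h₁
      simp only [hφM, map_mul, hφω, hσ.cube, map_neg] at h₂
      have h₃ : 2 * algebraMap M L (σ s - s) = 0 := by linear_combination h₁ + h₂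
      have h₄ := (mul_eq_zero.1 h₃).resolve_left h2L
      rw [h₄] at h₁
      have h₅ : σ t = -t := eq_neg_of_add_eq_zero_left
        ((map_eq_zero _).1 ((mul_eq_zero.1 h₁.symm).resolve_right hω0))
      refine ⟨sub_eq_zero.1 ((map_eq_zero _).1 h₄), ?_⟩
      have h₆ := hσ.cube t
      rw [h₅, map_neg, h₅, neg_neg, h₅] at h₆
      have h₇ : 2 * algebraMap M L t = 0 := by
        have := congrArg (algebraMap M L) h₆
        rw [map_neg] at this
        linear_combination -this
      exact (map_eq_zero _).1 ((mul_eq_zero.1 h₇).resolve_left h2L)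
    · rintro ⟨hs, rfl⟩
      simp [hs]
  constructor
  · rintro h ⟨s, t, hst, hw⟩
    have hz' := mt (hz s t).1 hst
    obtain ⟨x, hx, hxz⟩ := (exists_binomialMap_mul_eq_iff h6 hω0 hφω hz').2
      ((hcoord s t _ rfl).2 hw)
    exact hz' ((hfixK _).2 (h x _ hx hxz))
  · intro h x z hx hxz
    by_contra hzK
    have hz' := mt (hfixK z).1 hzK
    -- The coordinates of z are its even and odd parts under φ³.
    obtain ⟨s, hs⟩ := hfix ((z + φ (φ (φ z))) / 2) (by
      simp only [map_div₀, map_add, map_ofNat, h6, add_comm])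
    obtain ⟨t, ht⟩ := hfix ((z - φ (φ (φ z))) / (2 * ω)) (by
      simp only [map_div₀, map_sub, map_mul, map_ofNat, h6, hφω, map_neg]
      field_simp
      ring)
    have hzst : z = algebraMap M L s + algebraMap M L t * ω := by
      rw [hs, ht]; field_simp; ring
    refine h ⟨s, t, fun hst => hz' ?_, (hcoord s t z hzst).1
      ((exists_binomialMap_mul_eq_iff h6 hω0 hφω hz').1 ⟨x, hx, hxz⟩)⟩
    rw [hzst]
    exact (hz s t).2 hst

/-! ### The size of Γ -/

theorem Gam_eq [Fintype K] (hKM : Module.finrank K M = 3) (hKL : Module.finrank K L = 6)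
    (h2 : ringChar K ≠ 2) :
    Gam K M L = {w : M | w ≠ 1 ∧ IsNonzeroSquare (kap K (w / (w - 1)))} := by
  have : Module.Finite K L := Module.finite_of_finrank_pos (by rw [hKL]; norm_num)
  have : Module.Finite K M := Module.finite_of_finrank_pos (by rw [hKM]; norm_num)
  have : Finite L := Module.finite_of_finite K
  have : Finite M := Module.finite_of_finite K
  have hσ := isCubicGenerator_frobenius hKM
  obtain ⟨d, hd⟩ := FiniteField.exists_nonsquare h2
  have key : ∀ w : M, ¬IsBadNorm (FiniteField.frobeniusAlgHom K M) d w ↔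
      w ≠ 1 ∧ IsNonzeroSquare (kap K (w / (w - 1))) := by
    intro w
    by_cases hw : w = 1
    · simp [hw, hσ.isBadNorm_one d]
    · have hw' : w - 1 ≠ 0 := sub_ne_zero.2 hw
      rw [hσ.isBadNorm_iff_solvable d hw, hσ.solvable_iff h2 hd, not_not, IsNonzeroSquare]
      · simp [hw]
      · intro h
        rw [div_eq_one_iff_eq hw'] at h
        exact one_ne_zero (by linear_combination h : (1 : M) = 0)
  ext w
  simp only [Gam, Set.mem_ofPred_eq, isMaximumScattered_U_iff_not_isBadNorm hKM hKL h2 hd, ← key]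
  constructor
  · rintro ⟨b, hb, rfl⟩
    exact hb
  · intro h
    obtain ⟨b, rfl⟩ := FiniteField.norm_surjective M L w
    exact ⟨b, h, rfl⟩

/-- The map w ↦ w/(w - 1) is an involution of M minus 1. Since kap(1) = 1 is a nonzero square,
omitting A = 1 lowers the count by exactly one. -/
theorem ncard_Gam [Fintype K] (hKM : Module.finrank K M = 3) (hKL : Module.finrank K L = 6)
    (h2 : ringChar K ≠ 2) :
    2 * (Gam K M L).ncard + Fintype.card K ^ 2 + Fintype.card K + 3 = Fintype.card K ^ 3 := by
  classical
  have : Module.Finite K M := Module.finite_of_finrank_pos (by rw [hKM]; norm_num)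
  have : Finite M := Module.finite_of_finite K
  have := Fintype.ofFinite M
  have hσ := isCubicGenerator_frobenius hKM
  have hG := hσ.card_kap_isNonzeroSquare h2
  have h1 : IsNonzeroSquare (kap K (1 : M)) := by
    have : kap K (1 : M) = 1 := by
      have := Algebra.trace_algebraMap (S := M) (1 : K)
      rw [map_one, hKM] at this
      simp only [kap, one_pow, this, map_one]
      norm_num
    rw [this]
    exact ⟨one_ne_zero, IsSquare.one⟩
  have hinv : ∀ w : M, w ≠ 1 → w / (w - 1) ≠ 1 ∧ w / (w - 1) / (w / (w - 1) - 1) = w := by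
    intro w hw
    have hw' : w - 1 ≠ 0 := sub_ne_zero.2 hw
    have e : w / (w - 1) - 1 = 1 / (w - 1) := by field_simp; ring
    refine ⟨fun h => ?_, ?_⟩
    · rw [h, sub_self] at e
      exact one_div_ne_zero hw' e.symm
    · rw [e]; field_simp
  have himg : (fun w : M => w / (w - 1)) '' Gam K M L =
      ((Finset.univ.filter fun A : M => IsNonzeroSquare (kap K A)).erase 1 : Finset M) := by
    rw [Gam_eq hKM hKL h2]
    ext A
    simp only [Set.mem_image, Set.mem_ofPred_eq, Finset.coe_erase, Finset.coe_filter,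
      Finset.mem_univ, true_and, Set.mem_sdiff, Set.mem_singleton_iff]
    constructor
    · rintro ⟨w, ⟨hw, hk⟩, rfl⟩
      exact ⟨hk, (hinv w hw).1⟩
    · rintro ⟨hk, hA⟩
      exact ⟨A / (A - 1), ⟨(hinv A hA).1, by rwa [(hinv A hA).2]⟩, (hinv A hA).2⟩
  have hinj : Set.InjOn (fun w : M => w / (w - 1)) (Gam K M L) := by
    rw [Gam_eq hKM hKL h2]
    intro w hw w' hw' h
    dsimp only at h
    rw [← (hinv w hw.1).2, h, (hinv w' hw'.1).2]
  rw [← hinj.ncard_image, himg, Set.ncard_coe_finset,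
    Finset.card_erase_of_mem (by simpa using h1)]
  have hpos : 0 < (Finset.univ.filter fun A : M => IsNonzeroSquare (kap K A)).card :=
    Finset.card_pos.2 ⟨1, by simpa using h1⟩
  have hG' : 2 * (Finset.univ.filter fun A : M => IsNonzeroSquare (kap K A)).card +
      Fintype.card K ^ 2 + Fintype.card K + 1 = Fintype.card K ^ 3 := by
    convert hG
  omega

end

end LinearSets


theorem mainTheorem3 {K M L : Type*} [Field K] [Fintype K] [Field M] [Field L]
    [Algebra K M] [Algebra M L] [Algebra K L] [IsScalarTower K M L]
    (hKM : Module.finrank K M = 3) (hKL : Module.finrank K L = 6)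
    (q : ℕ) (hq : Fintype.card K = q) (hodd : Odd q) :
    ((LinearSets.Gam K M L).ncard : ℚ) = ((q : ℚ) ^ 3 - (q : ℚ) ^ 2 - (q : ℚ) - 3) / 2 ∧
    ((LinearSets.Gam K M L).ncard : ℤ)
      = ⌊(((q : ℚ) ^ 2 + (q : ℚ) + 1) * ((q : ℚ) - 2)) / 2⌋ := by
  have h2 : ringChar K ≠ 2 := by
    rw [Ne, FiniteField.even_card_iff_char_two, hq]
    have := Nat.odd_iff.1 hodd
    omega
  have h := LinearSets.ncard_Gam (M := M) (L := L) hKM hKL h2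
  rw [hq] at h
  have h' : 2 * ((LinearSets.Gam K M L).ncard : ℚ) + (q : ℚ) ^ 2 + q + 3 = (q : ℚ) ^ 3 := by
    exact_mod_cast h
  refine ⟨by linarith, ?_⟩
  symm
  -- The quantity under the floor exceeds |Γ| by exactly 1/2.
  rw [Int.floor_eq_iff]
  push_cast
  constructor <;> nlinarith
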